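/- All semigroups are finite unless said otherwise, and $S^1$ denotes $S$ with an identity adjoined. For $x,y\in S$ and $z_1,z_2,\dots\in S^1$ put $\lambda_0=x$, $\rho_0=y$, $\lambda_{n+1}=\lambda_n z_{n+1}\rho_n$ and $\rho_{n+1}=\rho_n z_{n+1}\lambda_n$. The semigroup $S$ is Mal'cev nilpotent if there is a positive integer $n$ such that $\lambda_n=\rho_n$ for all $x,y\in S$ and $z_1,\dots,z_n\in S^1$. Let $\mathsf{MN}$ be the class of all finite Mal'cev nilpotent semigroups. Let $\mathsf{BG}_{nil}$ be the class of all finite semigroups $S$ such that every element $a\in S$ has at most one inverse (an element $b$ with $aba=a$ and $bab=b$) and every subgroup of $S$ (that is, every subsemigroup that is a group) is nilpotent. For an element $x$ of a finite semigroup, $x^{\omega}$ is the unique idempotent power of $x$, and $x^{\omega-1}$ is the inverse of $x^{\omega}x$ in the maximal subgroup of $S$ with identity $x^{\omega}$. Put $$\Delta(y_1,y_2;z_1,z_2)=\bigl((y_1z_2)^{\omega-1}y_1z_1(y_2z_2)^{\omega-1}y_2z_1\bigr)^{\omega}(y_1z_2)^{\omega},$$ and let $\mathsf{MN}^{\star}$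 be the class of all finite semigroups $S$ that satisfy the $\kappa$-identity $\Delta(y_1,y_2;z_1,z_2)=\Delta(y_2,y_1;z_1,z_2)$, that is, in which it holds for all $y_1,y_2,z_1,z_2\in S$. **Theorem.** $\mathsf{MN}=\mathsf{MN}^{\star}\cap\mathsf{BG}_{nil}$. Moreover, a semigroup $S\in\mathsf{BG}_{nil}$ is Mal'cev nilpotent if and only if it has Property $\mathcal{P}_2$: whenever $y_1,y_2$ are elements of one $\mathcal{J}$-class $J$ of $S$ and there are $z_1,z_2\in S$ such that $y_1z_1y_2,\ y_2z_1y_1,\ y_1z_2y_1,\ y_2z_2y_2\in J$, then $y_1\mathrel{\mathcal{H}}y_2$. Here $\mathcal{J}$ and $\mathcal{H}$ are Green's relations. -/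

import Mathlib

universe u

section SemigroupNotions

variable {S : Type u} [Semigroup S]

/-- The pair `(λ_n, ρ_n)` for `x y` in `S` and `z 1, …, z n` in `S¹ = WithOne S`
(the value `z 0` is not used):
`λ_0 = x`, `ρ_0 = y`, `λ_{n+1} = λ_n z_{n+1} ρ_n`, `ρ_{n+1} = ρ_n z_{n+1} λ_n`.
The terms are computed in `S¹`, into which `S` embeds. -/
def malcevPair (x y : S) (z : ℕ → WithOne S) : ℕ → WithOne S × WithOne S
  | 0 => ((x : WithOne S), (y : WithOne S))
  | n + 1 =>
    ((malcevPair x y z n).1 * z (n + 1) * (malcevPair x y z n).2,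
      (malcevPair x y z n).2 * z (n + 1) * (malcevPair x y z n).1)

variable (S) in
/-- Nilpotency of a semigroup in the sense of Mal'cev. -/
def IsMalcevNilpotent : Prop :=
  ∃ n : ℕ, 0 < n ∧ ∀ (x y : S) (z : ℕ → WithOne S),
    (malcevPair x y z n).1 = (malcevPair x y z n).2

/-- `b` is a (generalized) inverse of `a`. -/
def IsSemigroupInverse (a b : S) : Prop :=
  a * b * a = a ∧ b * a * b = b

variable (S) in
/-- A block group: every element has at most one inverse. -/
def IsBlockGroup : Prop :=
  ∀ a b c : S, IsSemigroupInverse a b → IsSemigroupInverse a c → b = c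

variable (S) in
/-- Every subgroup of `S` (a subsemigroup that is a group) is nilpotent. -/
def HasNilpotentSubgroups : Prop :=
  ∀ (H : Subsemigroup S) (G : Type u) [Group G], Nonempty (H ≃* G) → Group.IsNilpotent G

/-- Green's relation `R`: `a S¹ = b S¹`. -/
def GreenR (a b : S) : Prop :=
  (∃ u : WithOne S, (a : WithOne S) = b * u) ∧ ∃ u : WithOne S, (b : WithOne S) = a * u

/-- Green's relation `L`: `S¹ a = S¹ b`. -/
def GreenL (a b : S) : Prop :=
  (∃ u : WithOne S, (a : WithOne S) = u * b) ∧ ∃ u : WithOne S, (b : WithOne S) = u * a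

/-- Green's relation `H`. -/
def GreenH (a b : S) : Prop :=
  GreenL a b ∧ GreenR a b

/-- Green's relation `J`: `S¹ a S¹ = S¹ b S¹`. -/
def GreenJ (a b : S) : Prop :=
  (∃ u v : WithOne S, (a : WithOne S) = u * b * v) ∧
    ∃ u v : WithOne S, (b : WithOne S) = u * a * v

variable (S) in
/-- Property `P₂`: if `y₁, y₂` lie in one `J`-class which, for some `z₁, z₂ ∈ S`, also contains
`y₁z₁y₂`, `y₂z₁y₁`, `y₁z₂y₁` and `y₂z₂y₂`, then `y₁` and `y₂` are `H`-related. -/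
def PropertyP₂ : Prop :=
  ∀ y₁ y₂ : S, GreenJ y₁ y₂ →
    (∃ z₁ z₂ : S, GreenJ (y₁ * z₁ * y₂) y₁ ∧ GreenJ (y₂ * z₁ * y₁) y₁ ∧
      GreenJ (y₁ * z₂ * y₁) y₁ ∧ GreenJ (y₂ * z₂ * y₂) y₁) →
    GreenH y₁ y₂

/-- `powSucc x n` is `x ^ (n + 1)`. -/
def powSucc (x : S) : ℕ → S
  | 0 => x
  | n + 1 => powSucc x n * x

theorem coe_powSucc (x : S) (n : ℕ) :
    ((powSucc x n : S) : WithOne S) = (x : WithOne S) ^ (n + 1) := by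
  induction n with
  | zero => simp [powSucc]
  | succ n ih => rw [powSucc, WithOne.coe_mul, ih, ← pow_succ]

theorem exists_isIdempotentElem_powSucc [Finite S] (x : S) :
    ∃ n : ℕ, IsIdempotentElem (powSucc x n) := by
  obtain ⟨i, j, hij, h⟩ := Finite.exists_ne_map_eq_of_infinite (powSucc x)
  wlog hlt : i < j generalizing i j
  · exact this j i hij.symm h.symm (lt_of_le_of_ne (not_lt.mp hlt) hij.symm)
  obtain ⟨p, rfl⟩ := Nat.exists_eq_add_of_lt hlt
  have h1 : (x : WithOne S) ^ (i + 1) = (x : WithOne S) ^ (i + 1 + (p + 1)) := by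
    rw [← coe_powSucc, h, coe_powSucc]
    congr 1
    omega
  have h2 : ∀ m : ℕ, (x : WithOne S) ^ (i + 1) = (x : WithOne S) ^ (i + 1 + m * (p + 1)) := by
    intro m
    induction m with
    | zero => simp
    | succ m ih =>
      rw [Nat.succ_mul, ← add_assoc, add_right_comm, pow_add _ (i + 1 + (p + 1)), ← h1, ← pow_add]
      exact ih
  refine ⟨(i + 1) * p + i, ?_⟩
  have e : (i + 1) * p + i + 1 = i + 1 + (i + 1) * p := by ring
  apply WithOne.coe_injective
  rw [WithOne.coe_mul, coe_powSucc, ← pow_add, e]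
  conv_rhs => rw [pow_add, h2 (i + 1), ← pow_add]
  congr 1
  ring

open Classical in
/-- `x ^ (omegaIndex x + 1)` is the first idempotent power `x ^ ω` of `x`. -/
noncomputable def omegaIndex [Finite S] (x : S) : ℕ :=
  Nat.find (exists_isIdempotentElem_powSucc x)

/-- The power `x ^ (ω - 1)`, the inverse of `x ^ ω x` in the group of which `x ^ ω` is the
identity. It is `x ^ (2k - 1)` for any `k > 0` such that `x ^ k` is idempotent. -/
noncomputable def omegaPred [Finite S] (x : S) : S :=
  powSucc x (2 * omegaIndex x)

/-- `x ^ (ω - 1) * x` is the idempotent power of `x`. -/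
theorem omegaPred_mul_self [Finite S] (x : S) :
    omegaPred x * x = powSucc x (omegaIndex x) ∧ IsIdempotentElem (powSucc x (omegaIndex x)) := by
  classical
  have h : IsIdempotentElem (powSucc x (omegaIndex x)) := by
    unfold omegaIndex
    convert Nat.find_spec (exists_isIdempotentElem_powSucc x)
  refine ⟨?_, h⟩
  have h' : powSucc x (omegaIndex x) * powSucc x (omegaIndex x) = powSucc x (omegaIndex x) := h
  rw [← h']
  apply WithOne.coe_injective
  rw [WithOne.coe_mul, WithOne.coe_mul, omegaPred, coe_powSucc, coe_powSucc, ← pow_succ, ← pow_add]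
  congr 1
  ring

end SemigroupNotions

/-- Terms in the signature `κ`, which consists of the multiplication and of the unary operation
`x ^ (ω - 1)`. -/
inductive KappaTerm (X : Type) : Type
  | var : X → KappaTerm X
  | mul : KappaTerm X → KappaTerm X → KappaTerm X
  | omegaPred : KappaTerm X → KappaTerm X

namespace KappaTerm

variable {X : Type}

instance : Mul (KappaTerm X) := ⟨KappaTerm.mul⟩

/-- The term `t ^ ω = t ^ (ω - 1) t`. -/
def omega (t : KappaTerm X) : KappaTerm X := t.omegaPred * t

/-- The value of a `κ`-term in a finite semigroup. -/
noncomputable def eval {S : Type u} [Semigroup S] [Finite S] (f : X → S) : KappaTerm X → S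
  | var i => f i
  | mul s t => eval f s * eval f t
  | omegaPred t => _root_.omegaPred (eval f t)

/-- `Δ(y₁, y₂; z₁, z₂) =
((y₁z₂)^{ω-1} y₁ z₁ (y₂z₂)^{ω-1} y₂ z₁)^ω (y₁z₂)^ω`. -/
def delta (y₁ y₂ z₁ z₂ : KappaTerm X) : KappaTerm X :=
  ((y₁ * z₂).omegaPred * y₁ * z₁ * (y₂ * z₂).omegaPred * y₂ * z₁).omega * (y₁ * z₂).omega

end KappaTerm

/-- A finite semigroup. -/
structure FiniteSemigroup : Type (u + 1) where
  carrier : Type u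
  [semigroup : Semigroup carrier]
  [finite : Finite carrier]

attribute [instance] FiniteSemigroup.semigroup FiniteSemigroup.finite

namespace FiniteSemigroup

/-- The class `⟦s = t⟧` of all finite semigroups that satisfy the `κ`-identity `s = t`. -/
def satisfying {X : Type} (s t : KappaTerm X) : Set FiniteSemigroup.{u} :=
  {S | ∀ f : X → S.carrier, s.eval f = t.eval f}

/-- The pseudovariety of all finite Mal'cev nilpotent semigroups. -/
def MN : Set FiniteSemigroup.{u} :=
  {S | IsMalcevNilpotent S.carrier}

/-- The pseudovariety of all finite block groups all of whose subgroups are nilpotent. -/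
def BGnil : Set FiniteSemigroup.{u} :=
  {S | IsBlockGroup S.carrier ∧ HasNilpotentSubgroups S.carrier}

/-- The pseudovariety defined by `Δ(y₁, y₂; z₁, z₂) = Δ(y₂, y₁; z₁, z₂)`; the variables
`y₁, y₂, z₁, z₂` are those with the indices `0, 1, 2, 3`. -/
def MNstar : Set FiniteSemigroup.{u} :=
  satisfying (X := Fin 4)
    (KappaTerm.delta (.var 0) (.var 1) (.var 2) (.var 3))
    (KappaTerm.delta (.var 1) (.var 0) (.var 2) (.var 3))

end FiniteSemigroup

/-! The hub is Property P₂; all computations take place in S¹, where being a block group means that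
R-related idempotents are equal and L-related ones too. Mal'cev nilpotency forces this and nilpotent
subgroups. It also forces P₂: under the hypotheses of P₂, alternating z₁ and z₂ keeps λ_{2k} in the
H-class of y₁ and ρ_{2k} in that of y₂ (`mulPair_two_mul_of_jRel`), so λ_n = ρ_n makes these classes
coincide. Conversely, by finiteness the pairs (λ_{2k}, ρ_{2k}) repeat. A cycle from (x, y) stays in
one J-class, and its first two z's satisfy the hypotheses of P₂, so x H y. The cycle then lives in
one H-class and translates to a cycle in a nilpotent group, where x = y
(`PropertyP₂.eq_of_mulPair_eq`). For a block group, P₂ is equivalent to the Δ-identity. Under the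
hypotheses of P₂ the two sides are (y₁z₂)^ω and (y₂z₂)^ω, whose equality yields y₁ H y₂. In general,
if g and h are the ω-powers heading the two sides, then g(y₁z₂)^{ω-1}y₁ and h(y₂z₂)^{ω-1}y₂ satisfy
those hypotheses, so g R h and g = h (`delta_eq_of_rRel`). -/

/-! ### Green's relations in finite monoids and in block groups. -/

section GreenMonoid

variable {M : Type u} [Monoid M]

/-- Green's relation `R` on a monoid. -/
def RRel (a b : M) : Prop := (∃ u : M, a = b * u) ∧ ∃ u : M, b = a * u

/-- Green's relation `L` on a monoid. -/
def LRel (a b : M) : Prop := (∃ u : M, a = u * b) ∧ ∃ u : M, b = u * a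

/-- Green's relation `J` on a monoid. -/
def JRel (a b : M) : Prop := (∃ u v : M, a = u * b * v) ∧ ∃ u v : M, b = u * a * v

/-- Both `R`-related and `L`-related idempotents are equal. -/
structure IsBlockMonoid (M : Type u) [Monoid M] : Prop where
  right : ∀ e f : M, IsIdempotentElem e → IsIdempotentElem f → e * f = f → f * e = e → e = f
  left : ∀ e f : M, IsIdempotentElem e → IsIdempotentElem f → e * f = e → f * e = f → e = f

namespace RRel

theorem refl (a : M) : RRel a a := ⟨⟨1, by simp⟩, ⟨1, by simp⟩⟩

theorem symm {a b : M} (h : RRel a b) : RRel b a := ⟨h.2, h.1⟩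

theorem trans {a b c : M} (h : RRel a b) (k : RRel b c) : RRel a c := by
  obtain ⟨⟨u, hu⟩, ⟨v, hv⟩⟩ := h
  obtain ⟨⟨s, hs⟩, ⟨t, ht⟩⟩ := k
  exact ⟨⟨s * u, by rw [hu, hs, mul_assoc]⟩, ⟨v * t, by rw [ht, hv, mul_assoc]⟩⟩

theorem jRel {a b : M} (h : RRel a b) : JRel a b := by
  obtain ⟨⟨u, hu⟩, ⟨v, hv⟩⟩ := h
  exact ⟨⟨1, u, by simpa using hu⟩, ⟨1, v, by simpa using hv⟩⟩

end RRel

namespace LRel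

theorem refl (a : M) : LRel a a := ⟨⟨1, by simp⟩, ⟨1, by simp⟩⟩

theorem symm {a b : M} (h : LRel a b) : LRel b a := ⟨h.2, h.1⟩

theorem trans {a b c : M} (h : LRel a b) (k : LRel b c) : LRel a c := by
  obtain ⟨⟨u, hu⟩, ⟨v, hv⟩⟩ := h
  obtain ⟨⟨s, hs⟩, ⟨t, ht⟩⟩ := k
  exact ⟨⟨u * s, by rw [hu, hs, mul_assoc]⟩, ⟨t * v, by rw [ht, hv, mul_assoc]⟩⟩

theorem jRel {a b : M} (h : LRel a b) : JRel a b := by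
  obtain ⟨⟨u, hu⟩, ⟨v, hv⟩⟩ := h
  exact ⟨⟨u, 1, by simpa using hu⟩, ⟨v, 1, by simpa using hv⟩⟩

end LRel

namespace JRel

theorem refl (a : M) : JRel a a := ⟨⟨1, 1, by simp⟩, ⟨1, 1, by simp⟩⟩

theorem symm {a b : M} (h : JRel a b) : JRel b a := ⟨h.2, h.1⟩

theorem trans {a b c : M} (h : JRel a b) (k : JRel b c) : JRel a c := by
  obtain ⟨⟨u, u', hu⟩, ⟨v, v', hv⟩⟩ := h
  obtain ⟨⟨s, s', hs⟩, ⟨t, t', ht⟩⟩ := k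
  exact ⟨⟨u * s, s' * u', by rw [hu, hs]; simp only [mul_assoc]⟩,
    ⟨t * v, v' * t', by rw [ht, hv]; simp only [mul_assoc]⟩⟩

/-- The `J`-class of `a z b` depends only on the `L`-class of `a` and the `R`-class of `b`. -/
theorem mul_of_lRel_rRel {a a' b b' : M} (h : LRel a a') (k : RRel b b') (z : M) :
    JRel (a * z * b) (a' * z * b') := by
  obtain ⟨⟨u, hu⟩, ⟨v, hv⟩⟩ := h
  obtain ⟨⟨s, hs⟩, ⟨t, ht⟩⟩ := k
  refine ⟨⟨u, s, ?_⟩, ⟨v, t, ?_⟩⟩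
  · rw [hu, hs]; simp only [mul_assoc]
  · rw [hv, ht]; simp only [mul_assoc]

end JRel

theorem eq_pow_mul_mul_pow {u x v : M} (h : x = u * x * v) (n : ℕ) :
    x = u ^ n * x * v ^ n := by
  induction n with
  | zero => simp
  | succ n ih =>
    calc x = u ^ n * x * v ^ n := ih
      _ = u ^ n * (u * x * v) * v ^ n := by rw [← h]
      _ = u ^ (n + 1) * x * v ^ (n + 1) := by
        rw [pow_succ u, pow_succ' v]; simp only [mul_assoc]

theorem eq_mul_pow {x v : M} (h : x = x * v) (n : ℕ) : x = x * v ^ n := by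
  simpa using eq_pow_mul_mul_pow (u := 1) (x := x) (v := v) (by simpa using h) n

theorem powSucc_eq_pow (x : M) (n : ℕ) : powSucc x n = x ^ (n + 1) := by
  induction n with
  | zero => simp [powSucc]
  | succ n ih => rw [powSucc, ih, ← pow_succ]

theorem mul_idempotent_of_lRel {e x : M} (he : IsIdempotentElem e) (h : LRel e x) : x * e = x := by
  obtain ⟨u, hu⟩ := h.2
  rw [hu, mul_assoc, he.eq]

theorem idempotent_mul_of_rRel {e x : M} (he : IsIdempotentElem e) (h : RRel e x) : e * x = x := by
  obtain ⟨u, hu⟩ := h.2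
  rw [hu, ← mul_assoc, he.eq]

theorem IsBlockMonoid.eq_of_rRel (hM : IsBlockMonoid M) {e f : M} (he : IsIdempotentElem e) (hf : IsIdempotentElem f)
    (h : RRel e f) : e = f :=
  hM.right e f he hf (idempotent_mul_of_rRel he h) (idempotent_mul_of_rRel hf h.symm)

theorem IsBlockMonoid.eq_of_lRel (hM : IsBlockMonoid M) {e f : M} (he : IsIdempotentElem e) (hf : IsIdempotentElem f)
    (h : LRel e f) : e = f :=
  hM.left e f he hf (mul_idempotent_of_lRel hf h.symm) (mul_idempotent_of_lRel he h)

variable [Finite M]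

theorem exists_isIdempotentElem_pow_succ (x : M) : ∃ n : ℕ, IsIdempotentElem (x ^ (n + 1)) := by
  obtain ⟨n, hn⟩ := exists_isIdempotentElem_powSucc x
  exact ⟨n, by rwa [powSucc_eq_pow] at hn⟩

/-- Stability of finite monoids. -/
theorem rRel_mul_right {x y : M} (h : JRel (x * y) x) : RRel (x * y) x := by
  obtain ⟨u, v, huv⟩ := h.2
  refine ⟨⟨y, rfl⟩, ?_⟩
  -- In x = uⁿ x (yv)ⁿ, an idempotent power of yv is absorbed on the right, so x is recovered from
  -- xy.
  obtain ⟨n, hn⟩ := exists_isIdempotentElem_pow_succ (y * v)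
  have h1 := eq_pow_mul_mul_pow (u := u) (x := x) (v := y * v)
    (by simpa only [mul_assoc] using huv) (n + 1)
  refine ⟨v * (y * v) ^ n, ?_⟩
  have h2 : x * y * (v * (y * v) ^ n) = x * (y * v) ^ (n + 1) := by
    rw [pow_succ']; simp only [mul_assoc]
  rw [h2]
  have h3 : x * (y * v) ^ (n + 1) = x := by
    conv_lhs => rw [h1]
    rw [mul_assoc, hn.eq, ← h1]
  exact h3.symm

theorem rRel_of_jRel {x y : M} (h : JRel x y) (hd : ∃ u, x = y * u) : RRel x y := by
  obtain ⟨u, rfl⟩ := hd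
  exact rRel_mul_right h

/-- Stability of finite monoids. -/
theorem lRel_mul_left {x y : M} (h : JRel (y * x) x) : LRel (y * x) x := by
  obtain ⟨u, v, huv⟩ := h.2
  refine ⟨⟨y, rfl⟩, ?_⟩
  obtain ⟨n, hn⟩ := exists_isIdempotentElem_pow_succ (u * y)
  have h1 := eq_pow_mul_mul_pow (u := u * y) (x := x) (v := v)
    (by simpa only [mul_assoc] using huv) (n + 1)
  refine ⟨(u * y) ^ n * u, ?_⟩
  have h2 : (u * y) ^ n * u * (y * x) = (u * y) ^ (n + 1) * x := by
    rw [pow_succ]; simp only [mul_assoc]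
  rw [h2]
  have h3 : (u * y) ^ (n + 1) * x = x := by
    conv_lhs => rw [h1]
    rw [← mul_assoc, ← mul_assoc, hn.eq, ← h1]
  exact h3.symm

theorem lRel_of_jRel {x y : M} (h : JRel x y) (hd : ∃ u, x = u * y) : LRel x y := by
  obtain ⟨u, rfl⟩ := hd
  exact lRel_mul_left h

/-- If `x y` is `J`-related to `x` and `y`, then `L_x ∩ R_y` contains an idempotent. -/
theorem exists_idempotent_of_jRel_mul {x y : M} (h : JRel (x * y) x) (hxy : JRel x y) :
    ∃ e : M, IsIdempotentElem e ∧ LRel e x ∧ RRel e y := by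
  obtain ⟨v, hv⟩ := (rRel_mul_right h).2
  obtain ⟨n, hn⟩ := exists_isIdempotentElem_pow_succ (y * v)
  have hx := eq_mul_pow (x := x) (v := y * v) (by rw [← mul_assoc]; exact hv) (n + 1)
  have hy : (y * v) ^ (n + 1) = y * (v * (y * v) ^ n) := by rw [pow_succ', mul_assoc]
  have hJ : JRel ((y * v) ^ (n + 1)) x := by
    refine ⟨?_, ⟨x, 1, by simpa using hx⟩⟩
    obtain ⟨p, q, hpq⟩ := hxy.2
    exact ⟨p, q * (v * (y * v) ^ n), by
      calc (y * v) ^ (n + 1) = y * (v * (y * v) ^ n) := hy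
        _ = p * x * q * (v * (y * v) ^ n) := by rw [← hpq]
        _ = _ := by simp only [mul_assoc]⟩
  exact ⟨_, hn, (lRel_of_jRel hJ.symm ⟨x, hx⟩).symm, rRel_of_jRel (hJ.trans hxy) ⟨_, hy⟩⟩

namespace IsBlockMonoid

/-- L_a ∩ R_f contains an idempotent; being R-related to f, it is f, and so f L a. -/
theorem mul_idempotent_eq (hM : IsBlockMonoid M) {a f : M} (hf : IsIdempotentElem f) (h : JRel (a * f) a)
    (haf : JRel a f) : a * f = a := by
  obtain ⟨g, hg, hga, hgf⟩ := exists_idempotent_of_jRel_mul h haf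
  rw [← hM.eq_of_rRel hg hf hgf]
  exact mul_idempotent_of_lRel hg hga

/-- If `z` maps the `L`-class of `u` to the `R`-class of `v`, and the `L`-class of `v'`, which is
matched with the `R`-class of `v`, to that of `t`, then `z²` maps the `L`-class of `u` to the
`R`-class of `t`. -/
theorem jRel_mul_sq_mul (hM : IsBlockMonoid M) {u v v' t z j : M}
    (h1 : JRel (u * z * v) j) (h2 : JRel (v' * z * t) j)
    (h3 : JRel (v' * v) j) (hu : JRel u j) (hv : JRel v j) (hv' : JRel v' j) :
    JRel (u * (z * z) * t) j := by
  obtain ⟨e, he, hev', hev⟩ := exists_idempotent_of_jRel_mul (h3.trans hv'.symm)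
    (hv'.trans hv.symm)
  have hej : JRel e j := hev.jRel.trans hv
  have h4 : JRel (u * z * e) j := (JRel.mul_of_lRel_rRel (LRel.refl u) hev z).trans h1
  have huz : JRel (u * z) j := by
    refine ⟨?_, ?_⟩
    · obtain ⟨p, q, h⟩ := hu.1
      exact ⟨p, q * z, by rw [h]; simp only [mul_assoc]⟩
    · obtain ⟨p, q, h⟩ := h1.2
      exact ⟨p, v * q, by rw [h]; simp only [mul_assoc]⟩
  have h5 : u * z * e = u * z := hM.mul_idempotent_eq he (h4.trans huz.symm) (huz.trans hej.symm)
  have h6 : LRel (u * z) v' := by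
    refine LRel.trans ?_ hev'
    exact lRel_of_jRel (huz.trans hej.symm) ⟨u * z, h5.symm⟩
  have h7 := JRel.mul_of_lRel_rRel h6 (RRel.refl t) z
  rw [← mul_assoc]
  exact h7.trans h2

end IsBlockMonoid

end GreenMonoid

/-! ### Mal'cev sequences and nilpotent groups. -/

section MalcevSequences

/-- The sequence `(λ_n, ρ_n)` in an arbitrary magma. -/
def mulPair {M : Type*} [Mul M] (x y : M) (z : ℕ → M) : ℕ → M × M
  | 0 => (x, y)
  | n + 1 =>
    ((mulPair x y z n).1 * z (n + 1) * (mulPair x y z n).2,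
      (mulPair x y z n).2 * z (n + 1) * (mulPair x y z n).1)

theorem malcevPair_eq_mulPair {S : Type u} [Semigroup S] (x y : S) (z : ℕ → WithOne S) (n : ℕ) :
    malcevPair x y z n = mulPair (x : WithOne S) (y : WithOne S) z n := by
  induction n with
  | zero => rfl
  | succ n ih => rw [malcevPair, mulPair, ih]

theorem mulPair_add {M : Type*} [Mul M] (x y : M) (z : ℕ → M) (i k : ℕ) :
    mulPair x y z (i + k) =
      mulPair (mulPair x y z i).1 (mulPair x y z i).2 (fun t => z (i + t)) k := by
  induction k with
  | zero => rfl
  | succ k ih => rw [← add_assoc, mulPair, mulPair, ih, add_assoc]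

theorem map_mulPair {M N F : Type*} [Mul M] [Mul N] [FunLike F M N] [MulHomClass F M N] (f : F)
    (x y : M) (z : ℕ → M) (n : ℕ) :
    mulPair (f x) (f y) (fun i => f (z i)) n =
      (f (mulPair x y z n).1, f (mulPair x y z n).2) := by
  induction n with
  | zero => rfl
  | succ n ih => rw [mulPair, mulPair, ih]; simp only [map_mul]

theorem mulPair_congr {M : Type*} [Mul M] (x y : M) {z z' : ℕ → M} {n : ℕ}
    (h : ∀ i ≤ n, z i = z' i) : mulPair x y z n = mulPair x y z' n := by
  induction n with
  | zero => rfl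
  | succ n ih => rw [mulPair, mulPair, ih fun i hi => h i (by omega), h (n + 1) le_rfl]

theorem mulPair_eq_of_le {M : Type*} [Mul M] {x y : M} {z : ℕ → M} {n m : ℕ} (hnm : n ≤ m)
    (h : (mulPair x y z n).1 = (mulPair x y z n).2) :
    (mulPair x y z m).1 = (mulPair x y z m).2 := by
  induction m, hnm using Nat.le_induction with
  | base => exact h
  | succ m _ ih => simp only [mulPair, ih]

theorem exists_coe_mulPair {S : Type u} [Semigroup S] (x y : S) (z : ℕ → WithOne S) (n : ℕ) :
    ∃ a b : S, mulPair (x : WithOne S) (y : WithOne S) z n = ((a : WithOne S), (b : WithOne S)) := by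
  induction n with
  | zero => exact ⟨x, y, rfl⟩
  | succ n ih =>
    obtain ⟨a, b, hab⟩ := ih
    rw [mulPair, hab]
    cases z (n + 1) with
    | one => exact ⟨a * b, b * a, by simp⟩
    | coe c => exact ⟨a * c * b, b * c * a, by simp⟩

/-- In a nilpotent group the sequence `(λ_n, ρ_n)` never returns to a start with `x ≠ y`. -/
theorem eq_of_mulPair_eq_of_isNilpotent (G : Type*) [Group G] [Group.IsNilpotent G] :
    ∀ (x y : G) (z : ℕ → G) (m : ℕ), 0 < m → mulPair x y z m = (x, y) → x = y := by
  refine Group.nilpotent_center_quotient_ind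
    (P := fun G _ _ => ∀ (x y : G) (z : ℕ → G) (m : ℕ), 0 < m → mulPair x y z m = (x, y) → x = y)
    G ?_ ?_
  · intro G _ _ x y _ _ _ _
    exact Subsingleton.elim x y
  · intro G _ _ ih x y z m hm h
    have h1 := map_mulPair (QuotientGroup.mk' (Subgroup.center G)) x y z m
    rw [h] at h1
    -- Modulo the centre x and y agree, so y = xc with c central. Then λ₁ = ρ₁, and the two
    -- sequences never separate again.
    have h2 := ih _ _ _ m hm h1
    have h3 : x⁻¹ * y ∈ Subgroup.center G := QuotientGroup.eq.mp h2
    rw [Subgroup.mem_center_iff] at h3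
    have h4 : (mulPair x y z 1).1 = (mulPair x y z 1).2 := by
      have h5 : y = x * (x⁻¹ * y) := by group
      generalize x⁻¹ * y = c at h3 h5
      subst h5
      simp only [mulPair, zero_add]
      rw [h3 x, ← mul_assoc, h3 (x * z 1)]
      simp only [mul_assoc]
    have h6 := mulPair_eq_of_le hm h4
    rwa [h] at h6

/-- Mal'cev's theorem: a group in which `λ_n = ρ_n` holds identically is nilpotent. -/
theorem isNilpotent_of_mulPair_eq (n : ℕ) : ∀ (G : Type u) [Group G],
    (∀ (x y : G) (z : ℕ → G), (mulPair x y z n).1 = (mulPair x y z n).2) →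
      Group.IsNilpotent G := by
  induction n with
  | zero =>
    intro G _ h
    have : Subsingleton G := ⟨fun x y => h x y fun _ => 1⟩
    infer_instance
  | succ n ih =>
    intro G _ h
    refine Group.of_quotient_center_nilpotent (ih _ ?_)
    intro x y z
    obtain ⟨x, rfl⟩ := QuotientGroup.mk_surjective x
    obtain ⟨y, rfl⟩ := QuotientGroup.mk_surjective y
    choose z' hz' using fun i => QuotientGroup.mk_surjective (z i)
    have h1 := map_mulPair (QuotientGroup.mk' (Subgroup.center G)) x y z' n
    have hz : (fun i => (QuotientGroup.mk' (Subgroup.center G)) (z' i)) = z :=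
      funext hz'
    rw [hz] at h1
    -- λ_n and ρ_n do not involve z_{n+1}, which can therefore be any w; this freedom makes ρ_n⁻¹λ_n
    -- central.
    have h2 : ∀ w : G, (mulPair x y z' n).1 * w * (mulPair x y z' n).2 =
        (mulPair x y z' n).2 * w * (mulPair x y z' n).1 := by
      intro w
      have h3 := h x y (Function.update z' (n + 1) w)
      have h4 : mulPair x y (Function.update z' (n + 1) w) n = mulPair x y z' n :=
        mulPair_congr x y fun i hi => Function.update_of_ne (by omega) _ _
      simpa only [mulPair, h4, Function.update_self] using h3
    change mulPair (x : G ⧸ Subgroup.center G) (y : G ⧸ Subgroup.center G) z n = _ at h1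
    rw [h1]
    generalize (mulPair x y z' n).1 = a at h2
    generalize (mulPair x y z' n).2 = b at h2
    refine (QuotientGroup.eq.mpr ?_).symm
    rw [Subgroup.mem_center_iff]
    intro w
    have h5 : ∀ w, b⁻¹ * a * w = w * (a * b⁻¹) := by
      intro w
      calc b⁻¹ * a * w = b⁻¹ * (a * w * b) * b⁻¹ := by group
        _ = w * (a * b⁻¹) := by rw [h2]; group
    have h6 : b⁻¹ * a = a * b⁻¹ := by simpa using h5 1
    rw [h5, h6]

end MalcevSequences

/-! ### Mal'cev nilpotent semigroups are block groups with nilpotent subgroups. -/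

section MalcevNilpotent

variable {S : Type u} [Semigroup S]

/-- Inverses b, c of a give R-related idempotents ab, ac and L-related ones ba, ca. Conversely, if e
and f are R- or L-related idempotents, both are inverses of e. -/
theorem isBlockMonoid_withOne_iff : IsBlockMonoid (WithOne S) ↔ IsBlockGroup S := by
  constructor
  · intro h a b c hb hc
    have coe_idem : ∀ {s : S}, s * s = s → IsIdempotentElem (s : WithOne S) := fun {s} hs => by
      rw [IsIdempotentElem, ← WithOne.coe_mul, hs]
    have hab : a * b = a * c := by
      refine WithOne.coe_injective (h.right _ _ (coe_idem ?_) (coe_idem ?_) ?_ ?_)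
      · rw [← mul_assoc, hb.1]
      · rw [← mul_assoc, hc.1]
      · rw [← WithOne.coe_mul, ← mul_assoc, hb.1]
      · rw [← WithOne.coe_mul, ← mul_assoc, hc.1]
    have hba : b * a = c * a := by
      refine WithOne.coe_injective (h.left _ _ (coe_idem ?_) (coe_idem ?_) ?_ ?_)
      · rw [mul_assoc, ← mul_assoc a, hb.1]
      · rw [mul_assoc, ← mul_assoc a, hc.1]
      · rw [← WithOne.coe_mul, mul_assoc, ← mul_assoc a, hc.1]
      · rw [← WithOne.coe_mul, mul_assoc, ← mul_assoc a, hb.1]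
    calc b = b * a * b := hb.2.symm
      _ = c * (a * b) := by rw [hba, mul_assoc]
      _ = c := by rw [hab, ← mul_assoc, hc.2]
  · intro h
    constructor
    · intro e f he hf h1 h2
      cases e with
      | one => simpa using h2.symm
      | coe e =>
        cases f with
        | one => simp at h1
        | coe f =>
          simp only [IsIdempotentElem, ← WithOne.coe_mul, WithOne.coe_inj] at he hf h1 h2 ⊢
          exact h e e f ⟨by simp [he], by simp [he]⟩ ⟨by rw [h1, h2], by rw [h2, h1]⟩
    · intro e f he hf h1 h2
      cases e with
      | one => simpa using h1.symm
      | coe e =>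
        cases f with
        | one => simp at h2
        | coe f =>
          simp only [IsIdempotentElem, ← WithOne.coe_mul, WithOne.coe_inj] at he hf h1 h2 ⊢
          exact h e e f ⟨by simp [he], by simp [he]⟩ ⟨by rw [h1, he], by rw [h2, hf]⟩

theorem IsMalcevNilpotent.mulPair_eq (h : IsMalcevNilpotent S) : ∃ n : ℕ, ∀ (x y : S)
    (z : ℕ → WithOne S), (mulPair (x : WithOne S) (y : WithOne S) z n).1 =
      (mulPair (x : WithOne S) (y : WithOne S) z n).2 := by
  obtain ⟨n, -, h⟩ := h
  exact ⟨n, fun x y z => by rw [← malcevPair_eq_mulPair]; exact h x y z⟩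

/-- With every z equal to 1, a pair of L-related idempotents is fixed and a pair of R-related ones
is swapped at each step, so distinct ones never merge. -/
theorem IsMalcevNilpotent.isBlockMonoid (h : IsMalcevNilpotent S) :
    IsBlockMonoid (WithOne S) := by
  obtain ⟨n, h⟩ := h.mulPair_eq
  have key : ∀ e f : S, (e * f = e ∧ f * e = f) ∨ (e * f = f ∧ f * e = e) → e = f := by
    intro e f hef
    have h1 : ∀ k, mulPair (e : WithOne S) (f : WithOne S) (fun _ => 1) k = (↑e, ↑f) ∨
        mulPair (e : WithOne S) (f : WithOne S) (fun _ => 1) k = (↑f, ↑e) := by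
      intro k
      induction k with
      | zero => exact Or.inl rfl
      | succ k ih =>
        rcases ih with ih | ih <;> rcases hef with hef | hef <;>
          simp [mulPair, ih, ← WithOne.coe_mul, hef.1, hef.2]
    have h2 := h e f fun _ => 1
    rcases h1 n with h1 | h1 <;> rw [h1] at h2
    · exact WithOne.coe_injective h2
    · exact WithOne.coe_injective h2.symm
  constructor
  · intro e f _ _ h1 h2
    cases e with
    | one => simpa using h2.symm
    | coe e =>
      cases f with
      | one => simp at h1
      | coe f =>
        simp only [← WithOne.coe_mul, WithOne.coe_inj] at h1 h2 ⊢
        exact key e f (Or.inr ⟨h1, h2⟩)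
  · intro e f _ _ h1 h2
    cases e with
    | one => simpa using h1.symm
    | coe e =>
      cases f with
      | one => simp at h2
      | coe f =>
        simp only [← WithOne.coe_mul, WithOne.coe_inj] at h1 h2 ⊢
        exact key e f (Or.inl ⟨h1, h2⟩)

theorem IsMalcevNilpotent.hasNilpotentSubgroups (h : IsMalcevNilpotent S) :
    HasNilpotentSubgroups S := by
  obtain ⟨n, h⟩ := h.mulPair_eq
  rintro H G _ ⟨φ⟩
  refine isNilpotent_of_mulPair_eq n G fun x y z => ?_
  let f : G →ₙ* WithOne S :=
    WithOne.coeMulHom.comp ((MulMemClass.subtype H).comp (φ.symm : G →ₙ* H))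
  have hf : Function.Injective f :=
    WithOne.coe_injective.comp (Subtype.val_injective.comp φ.symm.injective)
  have h1 := h (φ.symm x : S) (φ.symm y : S) fun i => f (z i)
  have h2 := map_mulPair f x y z n
  change mulPair ((φ.symm x : S) : WithOne S) ((φ.symm y : S) : WithOne S) _ n = _ at h2
  rw [h2] at h1
  exact hf h1

end MalcevNilpotent

/-! ### Property P₂: necessity, and extension to z₁, z₂ in S¹. -/

section PropertyP₂

/-- A step with z₁ moves the pair into R_x ∩ L_y and R_y ∩ L_x; the next, with z₂, moves it back to
H_x and H_y. Stability turns membership in J into these R- and L-relations. -/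
theorem mulPair_two_mul_of_jRel {M : Type u} [Monoid M] [Finite M] {x y z₁ z₂ : M}
    (hxy : JRel x y) (h1 : JRel (x * z₁ * y) x) (h2 : JRel (y * z₁ * x) x)
    (h3 : JRel (x * z₂ * x) x) (h4 : JRel (y * z₂ * y) x) (k : ℕ) :
    ((RRel (mulPair x y (fun i => if i % 2 = 1 then z₁ else z₂) (2 * k)).1 x ∧
      LRel (mulPair x y (fun i => if i % 2 = 1 then z₁ else z₂) (2 * k)).1 x) ∧
    (RRel (mulPair x y (fun i => if i % 2 = 1 then z₁ else z₂) (2 * k)).2 y ∧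
      LRel (mulPair x y (fun i => if i % 2 = 1 then z₁ else z₂) (2 * k)).2 y)) := by
  induction k with
  | zero => exact ⟨⟨RRel.refl _, LRel.refl _⟩, ⟨RRel.refl _, LRel.refl _⟩⟩
  | succ k ih =>
    have e1 : (2 * k + 1) % 2 = 1 := by omega
    have e2 : ¬ (2 * k + 1 + 1) % 2 = 1 := by omega
    rw [show 2 * (k + 1) = 2 * k + 1 + 1 by ring]
    simp only [mulPair, if_pos e1, if_neg e2]
    generalize (mulPair x y (fun i => if i % 2 = 1 then z₁ else z₂) (2 * k)).1 = a at ih ⊢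
    generalize (mulPair x y (fun i => if i % 2 = 1 then z₁ else z₂) (2 * k)).2 = b at ih ⊢
    obtain ⟨⟨hax, hax'⟩, hby, hby'⟩ := ih
    have j1 : JRel (a * z₁ * b) x := (JRel.mul_of_lRel_rRel hax' hby z₁).trans h1
    have j2 : JRel (b * z₁ * a) x := (JRel.mul_of_lRel_rRel hby' hax z₁).trans h2
    have r1 : RRel (a * z₁ * b) x :=
      (rRel_of_jRel (j1.trans hax.jRel.symm) ⟨z₁ * b, mul_assoc _ _ _⟩).trans hax
    have l1 : LRel (a * z₁ * b) y :=
      (lRel_of_jRel (j1.trans (hxy.trans hby.jRel.symm)) ⟨a * z₁, rfl⟩).trans hby'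
    have r2 : RRel (b * z₁ * a) y :=
      (rRel_of_jRel (j2.trans (hxy.trans hby.jRel.symm)) ⟨z₁ * a, mul_assoc _ _ _⟩).trans hby
    have l2 : LRel (b * z₁ * a) x :=
      (lRel_of_jRel (j2.trans hax.jRel.symm) ⟨b * z₁, rfl⟩).trans hax'
    have j3 := (JRel.mul_of_lRel_rRel l1 r2 z₂).trans h4
    have j4 := (JRel.mul_of_lRel_rRel l2 r1 z₂).trans h3
    refine ⟨⟨?_, ?_⟩, ?_, ?_⟩
    · exact (rRel_of_jRel (j3.trans r1.jRel.symm) ⟨_, mul_assoc _ _ _⟩).trans r1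
    · exact (lRel_of_jRel (j3.trans l2.jRel.symm) ⟨_, rfl⟩).trans l2
    · exact (rRel_of_jRel (j4.trans (hxy.trans r2.jRel.symm)) ⟨_, mul_assoc _ _ _⟩).trans r2
    · exact (lRel_of_jRel (j4.trans (hxy.trans l1.jRel.symm)) ⟨_, rfl⟩).trans l1

variable {S : Type u} [Semigroup S] [Finite S]

instance finite_withOne : Finite (WithOne S) := inferInstanceAs (Finite (Option S))

theorem IsMalcevNilpotent.propertyP₂ (h : IsMalcevNilpotent S) : PropertyP₂ S := by
  obtain ⟨n, h⟩ := h.mulPair_eq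
  rintro y₁ y₂ hJ ⟨z₁, z₂, h1, h2, h3, h4⟩
  have key := mulPair_two_mul_of_jRel (M := WithOne S) (x := y₁) (y := y₂) (z₁ := z₁) (z₂ := z₂)
    hJ h1 h2 h3 h4 n
  have h5 := mulPair_eq_of_le (show n ≤ 2 * n by omega)
    (h y₁ y₂ fun i => if i % 2 = 1 then z₁ else z₂)
  rw [h5] at key
  exact ⟨key.1.2.symm.trans key.2.2, key.1.1.symm.trans key.2.1⟩

/-- In a block group, `P₂` also holds for `z₁` and `z₂` in `S¹`. -/
theorem PropertyP₂.withOne (hP : PropertyP₂ S) (hM : IsBlockMonoid (WithOne S)) {y₁ y₂ : S}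
    (hJ : JRel (y₁ : WithOne S) y₂) {z₁ z₂ : WithOne S}
    (h1 : JRel (y₁ * z₁ * y₂) (y₁ : WithOne S)) (h2 : JRel (y₂ * z₁ * y₁) (y₁ : WithOne S))
    (h3 : JRel (y₁ * z₂ * y₁) (y₁ : WithOne S)) (h4 : JRel (y₂ * z₂ * y₂) (y₁ : WithOne S)) :
    GreenH y₁ y₂ := by
  have r := JRel.refl (y₁ : WithOne S)
  cases z₁ with
  | one =>
    rw [mul_one] at h1 h2
    cases z₂ with
    | one =>
      rw [mul_one] at h3 h4
      -- The idempotents of L_{y₁} ∩ R_{y₂}, L_{y₂} ∩ R_{y₁} and H_{y₁} all coincide in a block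
      -- group.
      obtain ⟨e, he, hel, her⟩ := exists_idempotent_of_jRel_mul h1 hJ
      obtain ⟨f, hf, hfl, hfr⟩ := exists_idempotent_of_jRel_mul (h2.trans hJ) hJ.symm
      obtain ⟨g, hg, hgl, hgr⟩ := exists_idempotent_of_jRel_mul h3 r
      have heg := hM.eq_of_lRel he hg (hel.trans hgl.symm)
      have hfg := hM.eq_of_rRel hf hg (hfr.trans hgr.symm)
      subst heg
      subst hfg
      exact ⟨hel.symm.trans hfl, hfr.symm.trans her⟩
    | coe z =>
      -- The square of z replaces the adjoined identity: y₁ and y₂ are matched crosswise by 1, so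
      -- going through z twice has the effect required of z₁.
      exact hP y₁ y₂ hJ ⟨z * z, z, hM.jRel_mul_sq_mul h3 h4 h2 r r hJ.symm,
        hM.jRel_mul_sq_mul h4 h3 h1 hJ.symm hJ.symm r, h3, h4⟩
  | coe z =>
    cases z₂ with
    | one =>
      rw [mul_one] at h3 h4
      exact hP y₁ y₂ hJ ⟨z, z * z, h1, h2, hM.jRel_mul_sq_mul h1 h2 h4 r hJ.symm hJ.symm,
        hM.jRel_mul_sq_mul h2 h1 h3 hJ.symm r r⟩
    | coe z' => exact hP y₁ y₂ hJ ⟨z, z', h1, h2, h3, h4⟩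

end PropertyP₂

/-! ### Cycles inside one H-class. -/

section CornerMonoid

variable {S : Type u} [Semigroup S]

/-- The monoid `e S e`. -/
abbrev IsIdempotentElem.cornerMonoid {e : S} (he : IsIdempotentElem e) :
    Monoid (Subsemigroup.corner e) where
  one := ⟨e, (Subsemigroup.mem_corner_iff he).mpr ⟨he, he⟩⟩
  one_mul a := Subtype.ext ((Subsemigroup.mem_corner_iff he).mp a.2).1
  mul_one a := Subtype.ext ((Subsemigroup.mem_corner_iff he).mp a.2).2

theorem HasNilpotentSubgroups.isNilpotent_units_corner (h : HasNilpotentSubgroups S) {e : S}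
    (he : IsIdempotentElem e) :
    letI := he.cornerMonoid
    Group.IsNilpotent (Subsemigroup.corner e)ˣ := by
  let := he.cornerMonoid
  let f : (Subsemigroup.corner e)ˣ →ₙ* S := ⟨fun u => (u.val : S), fun _ _ => rfl⟩
  have hf : Function.Injective f := Subtype.val_injective.comp Units.val_injective
  refine h f.srange _ ⟨(MulEquiv.ofBijective f.srangeRestrict ⟨fun a b hab => hf ?_, ?_⟩).symm⟩
  · have h1 := congrArg Subtype.val hab
    exact h1
  · exact f.srangeRestrict_surjective

theorem exists_coe_eq_coe_mul (a : S) (u : WithOne S) : ∃ s : S, (s : WithOne S) = a * u := by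
  cases u with
  | one => exact ⟨a, by simp⟩
  | coe u => exact ⟨a * u, by simp⟩

variable [Finite S]

/-- A cycle of `(λ_n, ρ_n)` inside one `H`-class is constant if the subgroups are nilpotent. -/
theorem HasNilpotentSubgroups.eq_of_mulPair_eq (hS : HasNilpotentSubgroups S) {x y : S}
    {z : ℕ → WithOne S} {m : ℕ} (hm : 0 < m)
    (h : mulPair (x : WithOne S) (y : WithOne S) z m = (↑x, ↑y))
    (h1 : ∀ k ≤ m, RRel (mulPair (x : WithOne S) (y : WithOne S) z k).1 ↑x ∧
      LRel (mulPair (x : WithOne S) (y : WithOne S) z k).1 ↑x)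
    (h2 : ∀ k ≤ m, RRel (mulPair (x : WithOne S) (y : WithOne S) z k).2 ↑x ∧
      LRel (mulPair (x : WithOne S) (y : WithOne S) z k).2 ↑x) : x = y := by
  let H : Set (WithOne S) := {h | RRel h ↑x ∧ LRel h ↑x}
  have hx : (x : WithOne S) ∈ H := ⟨RRel.refl _, LRel.refl _⟩
  have hy : (y : WithOne S) ∈ H := h2 0 (Nat.zero_le _)
  have hcl : ∀ k < m, ∀ a ∈ H, ∀ b ∈ H, a * z (k + 1) * b ∈ H := by
    intro k hk a ha b hb
    have hJ : JRel (a * z (k + 1) * b) ↑x := by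
      have h3 := (h1 (k + 1) hk).1.jRel
      refine JRel.trans ?_ h3
      exact JRel.mul_of_lRel_rRel (ha.2.trans (h1 k hk.le).2.symm) (hb.1.trans (h2 k hk.le).1.symm)
        _
    exact ⟨(rRel_of_jRel (hJ.trans ha.1.jRel.symm) ⟨_, mul_assoc _ _ _⟩).trans ha.1,
      (lRel_of_jRel (hJ.trans hb.1.jRel.symm) ⟨_, rfl⟩).trans hb.2⟩
  -- H is a group under (a, b) ↦ awb. Its identity is `h₀` below, and a ↦ aw carries it into the
  -- units of the corner at the idempotent e = h₀w.
  obtain ⟨w, hw⟩ : ∃ w, w = z 1 := ⟨_, rfl⟩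
  have hclw : ∀ a ∈ H, ∀ b ∈ H, a * w * b ∈ H := by rw [hw]; exact hcl 0 hm
  have hpow : ∀ n : ℕ, (↑x * w) ^ n * ↑x ∈ H := by
    intro n
    induction n with
    | zero => simpa using hx
    | succ n ih =>
      rw [pow_succ', mul_assoc]
      exact hclw _ hx _ ih
  obtain ⟨n, hn⟩ := exists_isIdempotentElem_pow_succ (↑x * w)
  obtain ⟨h₀, hh₀⟩ : ∃ h₀, h₀ = (↑x * w) ^ n * ↑x := ⟨_, rfl⟩
  have hh₀H : h₀ ∈ H := hh₀ ▸ hpow n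
  obtain ⟨e, he⟩ : ∃ e, e = h₀ * w := ⟨_, rfl⟩
  have hepow : e = (↑x * w) ^ (n + 1) := by rw [he, hh₀, pow_succ, mul_assoc]
  have hee : IsIdempotentElem e := hepow ▸ hn
  have heH : ∀ a ∈ H, e * a = a := by
    intro a ha
    have hR : RRel (e * ↑x) ↑x := by rw [hepow]; exact (hpow (n + 1)).1
    obtain ⟨v, hv⟩ := (ha.1.trans hR.symm).1
    rw [hv, ← mul_assoc, ← mul_assoc, hee.eq]
  have hwh₀ : ∀ a ∈ H, a * w * h₀ = a := by
    intro a ha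
    obtain ⟨u, hu⟩ := (ha.2.trans hh₀H.2.symm).1
    rw [hu, mul_assoc u, ← he, mul_assoc, heH _ hh₀H]
  have hwe : ∀ a ∈ H, a * w * e = a * w := by
    intro a ha
    rw [he, ← mul_assoc, hwh₀ a ha]
  have hcoe : ∀ a ∈ H, ∀ u, ∃ s : S, (s : WithOne S) = a * u := by
    intro a ha u
    obtain ⟨v, hv⟩ := ha.1.1
    rw [hv, mul_assoc]
    exact exists_coe_eq_coe_mul x _
  obtain ⟨e₀, he₀⟩ := hcoe h₀ hh₀H w
  rw [← he] at he₀
  have hid : IsIdempotentElem e₀ := WithOne.coe_injective (by rw [WithOne.coe_mul, he₀, hee.eq])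
  let := hid.cornerMonoid
  have := hS.isNilpotent_units_corner hid
  let ι : (Subsemigroup.corner e₀)ˣ →ₙ* WithOne S := ⟨fun u => ((u.val : S) : WithOne S),
    fun _ _ => rfl⟩
  have hι : Function.Injective ι :=
    WithOne.coe_injective.comp (Subtype.val_injective.comp Units.val_injective)
  have hunit : ∀ a ∈ H, ∃ g, ι g = a * w := by
    intro a ha
    obtain ⟨s, hs⟩ := hcoe a ha w
    obtain ⟨u, hu⟩ := (hclw a ha h₀ hh₀H).2.trans hh₀H.2.symm |>.2
    obtain ⟨t, ht⟩ := exists_coe_eq_coe_mul e₀ (u * e)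
    rw [he₀] at ht
    have hs' : s ∈ Subsemigroup.corner e₀ := by
      rw [Subsemigroup.mem_corner_iff hid]
      constructor <;> apply WithOne.coe_injective <;> rw [WithOne.coe_mul, hs, he₀]
      · rw [← mul_assoc, heH a ha]
      · exact hwe a ha
    have ht' : t ∈ Subsemigroup.corner e₀ := by
      rw [Subsemigroup.mem_corner_iff hid]
      constructor <;> apply WithOne.coe_injective <;> rw [WithOne.coe_mul, ht, he₀]
      · rw [← mul_assoc, hee.eq]
      · rw [mul_assoc, mul_assoc, hee.eq]
    have hts : t * s = e₀ := by
      apply WithOne.coe_injective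
      have h3 : u * (a * w) = e := by
        calc u * (a * w) = u * (a * w * e) := by rw [hwe a ha]
          _ = u * (a * w * h₀) * w := by rw [he]; simp only [mul_assoc]
          _ = e := by rw [← hu, he]
      rw [WithOne.coe_mul, hs, ht, he₀, mul_assoc, mul_assoc, ← mul_assoc e a, heH a ha, h3,
        hee.eq]
    have hts' : (⟨t, ht'⟩ : Subsemigroup.corner e₀) * ⟨s, hs'⟩ = 1 := Subtype.ext hts
    exact ⟨⟨⟨s, hs'⟩, ⟨t, ht'⟩, mul_eq_one_comm.mp hts', hts'⟩, hs⟩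
  obtain ⟨X, hX⟩ := hunit x hx
  obtain ⟨Y, hY⟩ := hunit y hy
  have hC : ∀ k, ∃ c, k < m → ι c = h₀ * z (k + 1) * h₀ * w := by
    intro k
    by_cases hk : k < m
    · obtain ⟨c, hc⟩ := hunit _ (hcl k hk h₀ hh₀H h₀ hh₀H)
      exact ⟨c, fun _ => hc⟩
    · exact ⟨1, fun h => absurd h hk⟩
  choose C hC using hC
  have key : ∀ k ≤ m, ι (mulPair X Y (fun i => C (i - 1)) k).1 =
        (mulPair (x : WithOne S) (y : WithOne S) z k).1 * w ∧
      ι (mulPair X Y (fun i => C (i - 1)) k).2 =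
        (mulPair (x : WithOne S) (y : WithOne S) z k).2 * w := by
    intro k hk
    induction k with
    | zero => exact ⟨hX, hY⟩
    | succ k ih =>
      have hstep : ∀ a ∈ H, ∀ b ∈ H, a * w * (h₀ * z (k + 1) * h₀ * w) * (b * w) =
          a * z (k + 1) * b * w := by
        intro a ha b hb
        calc a * w * (h₀ * z (k + 1) * h₀ * w) * (b * w)
            = (a * w * h₀) * z (k + 1) * (h₀ * w * b) * w := by simp only [mul_assoc]
          _ = a * z (k + 1) * b * w := by rw [hwh₀ a ha, ← he, heH b hb]
      obtain ⟨ih1, ih2⟩ := ih (by omega)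
      have hA := h1 k (by omega)
      have hB := h2 k (by omega)
      simp only [mulPair, map_mul, Nat.add_sub_cancel, hC k hk, ih1, ih2]
      exact ⟨hstep _ hA _ hB, hstep _ hB _ hA⟩
  have hloop : mulPair X Y (fun i => C (i - 1)) m = (X, Y) := by
    have hk := key m le_rfl
    rw [h] at hk
    exact Prod.ext (hι (hk.1.trans hX.symm)) (hι (hk.2.trans hY.symm))
  have hXY := eq_of_mulPair_eq_of_isNilpotent _ X Y _ m hm hloop
  apply WithOne.coe_injective
  rw [← hwh₀ x hx, ← hX, hXY, hY, hwh₀ y hy]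

end CornerMonoid

/-! ### Arbitrary cycles, and sufficiency of P₂. -/

section Cycles

variable {M : Type u} [Monoid M]

theorem mulPair_swap (x y : M) (z : ℕ → M) (n : ℕ) :
    mulPair y x z n = (mulPair x y z n).swap := by
  induction n with
  | zero => rfl
  | succ n ih => rw [mulPair, mulPair, ih]; rfl

theorem exists_mulPair_fst_add (x y : M) (z : ℕ → M) (i k : ℕ) :
    ∃ u, (mulPair x y z (i + k)).1 = (mulPair x y z i).1 * u := by
  induction k with
  | zero => exact ⟨1, by simp⟩
  | succ k ih =>
    obtain ⟨u, hu⟩ := ih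
    exact ⟨u * z (i + k + 1) * (mulPair x y z (i + k)).2, by
      rw [← add_assoc, mulPair, hu]; simp only [mul_assoc]⟩

/-- λ_{n+1} ends in ρ_n and ρ_{n+1} ends in λ_n, so λ returns as a right factor only after two
steps; as a left factor it persists at every step. -/
theorem exists_mulPair_fst_add_two_mul (x y : M) (z : ℕ → M) (i k : ℕ) :
    ∃ u, (mulPair x y z (i + 2 * k)).1 = u * (mulPair x y z i).1 := by
  induction k with
  | zero => exact ⟨1, by simp⟩
  | succ k ih =>
    obtain ⟨u, hu⟩ := ih
    refine ⟨(mulPair x y z (i + 2 * k + 1)).1 * z (i + 2 * k + 1 + 1) *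
      (mulPair x y z (i + 2 * k)).2 * z (i + 2 * k + 1) * u, ?_⟩
    rw [show i + 2 * (k + 1) = i + 2 * k + 1 + 1 by ring]
    rw [mulPair, mulPair]
    dsimp only
    rw [hu]
    simp only [mul_assoc]

variable {x y : M} {z : ℕ → M} {m : ℕ}

theorem rRel_of_mulPair_eq (h : mulPair x y z m = (x, y)) {k : ℕ} (hk : k ≤ m) :
    RRel (mulPair x y z k).1 x := by
  obtain ⟨u, hu⟩ := exists_mulPair_fst_add x y z 0 k
  obtain ⟨v, hv⟩ := exists_mulPair_fst_add x y z k (m - k)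
  rw [zero_add] at hu
  rw [Nat.add_sub_cancel' hk, h] at hv
  exact ⟨⟨u, hu⟩, ⟨v, hv⟩⟩

theorem lRel_even_of_mulPair_eq (h : mulPair x y z (2 * m) = (x, y)) {k : ℕ} (hk : k ≤ m) :
    LRel (mulPair x y z (2 * k)).1 x := by
  obtain ⟨u, hu⟩ := exists_mulPair_fst_add_two_mul x y z 0 k
  obtain ⟨v, hv⟩ := exists_mulPair_fst_add_two_mul x y z (2 * k) (m - k)
  rw [zero_add] at hu
  rw [← mul_add, Nat.add_sub_cancel' hk, h] at hv
  exact ⟨⟨u, hu⟩, ⟨v, hv⟩⟩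

theorem mulPair_swap_eq (h : mulPair x y z m = (x, y)) : mulPair y x z m = (y, x) := by
  rw [mulPair_swap, h]; rfl

/-- λ_{2k+1} ends in ρ_{2k}, and ρ_{2k+2} ends in λ_{2k+1}; both ρ's are L-related to y. -/
theorem lRel_odd_of_mulPair_eq (h : mulPair x y z (2 * m) = (x, y)) {k : ℕ} (hk : k < m) :
    LRel (mulPair x y z (2 * k + 1)).1 y := by
  have h1 := lRel_even_of_mulPair_eq (mulPair_swap_eq h) hk.le
  have h2 := lRel_even_of_mulPair_eq (mulPair_swap_eq h) (show k + 1 ≤ m from hk)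
  rw [mulPair_swap x y] at h1 h2
  refine ⟨?_, ?_⟩
  · obtain ⟨u, hu⟩ := h1.1
    refine ⟨(mulPair x y z (2 * k)).1 * z (2 * k + 1) * u, ?_⟩
    rw [mul_assoc, ← hu]
    rfl
  · obtain ⟨u, hu⟩ := h2.2
    exact ⟨u * ((mulPair x y z (2 * k + 1)).2 * z (2 * k + 1 + 1)), by
      rw [mul_assoc]; exact hu⟩

variable {S : Type u} [Semigroup S] [Finite S]

theorem PropertyP₂.eq_of_mulPair_eq (hP : PropertyP₂ S) (hM : IsBlockMonoid (WithOne S))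
    (hS : HasNilpotentSubgroups S) {x y : S} {z : ℕ → WithOne S} {m : ℕ} (hm : 0 < m)
    (h : mulPair (x : WithOne S) (y : WithOne S) z (2 * m) = (↑x, ↑y)) : x = y := by
  have h' := mulPair_swap_eq h
  have r1 := rRel_of_mulPair_eq h (show 1 ≤ 2 * m by omega)
  have r1' := rRel_of_mulPair_eq h' (show 1 ≤ 2 * m by omega)
  have r2 := rRel_of_mulPair_eq h (show 2 ≤ 2 * m by omega)
  have r2' := rRel_of_mulPair_eq h' (show 2 ≤ 2 * m by omega)
  have l1 := lRel_odd_of_mulPair_eq h hm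
  have l1' := lRel_odd_of_mulPair_eq h' hm
  have hJ : JRel (x : WithOne S) y := r1.jRel.symm.trans l1.jRel
  have hH : GreenH x y := by
    -- Here z₁ is `z 1`, since λ₁ and ρ₁ lie in J. As λ₁ L y and ρ₁ R y, the product y · z 2 · y is
    -- J-related to λ₂; symmetrically for x and ρ₂.
    refine hP.withOne hM hJ r1.jRel (r1'.jRel.trans hJ.symm) (z₂ := z 2) ?_ ?_
    · have h3 := JRel.mul_of_lRel_rRel l1'.symm r1.symm (z 2)
      simpa [mulPair] using (h3.trans r2'.jRel).trans hJ.symm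
    · have h3 := JRel.mul_of_lRel_rRel l1.symm r1'.symm (z 2)
      simpa [mulPair] using h3.trans r2.jRel
  have key : ∀ {a b : S}, GreenH a b →
      mulPair (a : WithOne S) (b : WithOne S) z (2 * m) = (↑a, ↑b) → ∀ k ≤ 2 * m,
        RRel (mulPair (a : WithOne S) (b : WithOne S) z k).1 ↑a ∧
          LRel (mulPair (a : WithOne S) (b : WithOne S) z k).1 ↑a := by
    intro a b hab hl k hk
    refine ⟨rRel_of_mulPair_eq hl hk, ?_⟩
    rcases Nat.even_or_odd' k with ⟨s, rfl | rfl⟩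
    · exact lRel_even_of_mulPair_eq hl (by omega)
    · exact (lRel_odd_of_mulPair_eq hl (by omega)).trans (LRel.symm hab.1)
  have hH' : GreenH y x := ⟨LRel.symm hH.1, RRel.symm hH.2⟩
  refine hS.eq_of_mulPair_eq (by omega) h (key hH h) fun k hk => ?_
  have h3 := key hH' h' k hk
  rw [mulPair_swap (x : WithOne S) y] at h3
  exact ⟨h3.1.trans hH'.2, h3.2.trans hH'.1⟩

theorem PropertyP₂.isMalcevNilpotent (hP : PropertyP₂ S) (hB : IsBlockGroup S)
    (hS : HasNilpotentSubgroups S) : IsMalcevNilpotent S := by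
  have hM := isBlockMonoid_withOne_iff.mpr hB
  cases nonempty_fintype (WithOne S × WithOne S)
  -- The pigeonhole is applied to even indices only, so that the cycle has even length; the bound
  -- exceeds all these indices.
  refine ⟨2 * Fintype.card (WithOne S × WithOne S) + 1, by omega, fun x y z => ?_⟩
  rw [malcevPair_eq_mulPair]
  obtain ⟨i, j, hij, h⟩ := Fintype.exists_ne_map_eq_of_card_lt
    (fun i : Fin (Fintype.card (WithOne S × WithOne S) + 1) =>
      mulPair (x : WithOne S) (y : WithOne S) z (2 * i)) (by simp)
  wlog hlt : i < j generalizing i j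
  · exact this j i hij.symm h.symm (lt_of_le_of_ne (not_lt.mp hlt) hij.symm)
  have hlt' : (i : ℕ) < j := hlt
  obtain ⟨a, b, hab⟩ := exists_coe_mulPair x y z (2 * i)
  have h1 : mulPair (x : WithOne S) (y : WithOne S) z (2 * i + 2 * (j - i : ℕ)) = (↑a, ↑b) := by
    rw [← mul_add, Nat.add_sub_cancel' hlt'.le, ← hab]
    exact h.symm
  rw [mulPair_add, hab] at h1
  have h2 := hP.eq_of_mulPair_eq hM hS (Nat.sub_pos_of_lt hlt') h1
  refine mulPair_eq_of_le (show 2 * (i : ℕ) ≤ _ by have := i.2; omega) ?_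
  rw [hab, h2]

end Cycles

/-! ### The two sides of the Δ-identity in a monoid. -/

section Delta

variable {M : Type u} [Monoid M]

/-- Here cᵢ stands for (yᵢz₂)^{ω-1}yᵢ and eᵢ for (yᵢz₂)^ω. The point is that gc₁ and hc₂, where g
and h are the two idempotent powers, satisfy the hypotheses of P₂ and are R-related to g and h. -/
theorem delta_eq_of_rRel (hM : IsBlockMonoid M) {c₁ c₂ z₁ z₂ e₁ e₂ : M}
    (he₁ : IsIdempotentElem e₁) (he₂ : IsIdempotentElem e₂)
    (hc₁ : c₁ * z₂ = e₁) (hc₂ : c₂ * z₂ = e₂) (hec₁ : e₁ * c₁ = c₁) (hec₂ : e₂ * c₂ = c₂)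
    {k l : ℕ} (hk : IsIdempotentElem ((c₁ * z₁ * c₂ * z₁) ^ (k + 1)))
    (hl : IsIdempotentElem ((c₂ * z₁ * c₁ * z₁) ^ (l + 1)))
    (hP : ∀ y₁ y₂ : M, y₁ = (c₁ * z₁ * c₂ * z₁) ^ (k + 1) * c₁ →
      y₂ = (c₂ * z₁ * c₁ * z₁) ^ (l + 1) * c₂ → JRel y₁ y₂ →
      JRel (y₁ * z₁ * y₂) y₁ → JRel (y₂ * z₁ * y₁) y₁ →
      JRel (y₁ * z₂ * y₁) y₁ → JRel (y₂ * z₂ * y₂) y₁ → RRel y₁ y₂) :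
    (c₁ * z₁ * c₂ * z₁) ^ (k + 1) * e₁ = (c₂ * z₁ * c₁ * z₁) ^ (l + 1) * e₂ := by
  obtain ⟨a, ha⟩ : ∃ a, a = c₁ * z₁ := ⟨_, rfl⟩
  obtain ⟨b, hb⟩ : ∃ b, b = c₂ * z₁ := ⟨_, rfl⟩
  -- A common exponent lets a and b intertwine the two idempotents: ga = ah and hb = bg.
  obtain ⟨n, hn⟩ : ∃ n, n + 1 = (k + 1) * (l + 1) := ⟨k * l + k + l, by ring⟩
  have hg' : (c₁ * z₁ * c₂ * z₁) ^ (k + 1) = (a * b) ^ (n + 1) := by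
    rw [hn, pow_mul, ha, hb, ← mul_assoc, hk.pow_succ_eq]
  have hh' : (c₂ * z₁ * c₁ * z₁) ^ (l + 1) = (b * a) ^ (n + 1) := by
    rw [hn, mul_comm (k + 1), pow_mul, ha, hb, ← mul_assoc, hl.pow_succ_eq]
  rw [hg'] at hk hP ⊢
  rw [hh'] at hl hP ⊢
  obtain ⟨g, hg⟩ : ∃ g, g = (a * b) ^ (n + 1) := ⟨_, rfl⟩
  obtain ⟨h, hh⟩ : ∃ h, h = (b * a) ^ (n + 1) := ⟨_, rfl⟩
  rw [← hg] at hk hP ⊢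
  rw [← hh] at hl hP ⊢
  have hea : e₁ * a = a := by rw [ha, ← mul_assoc, hec₁]
  have heb : e₂ * b = b := by rw [hb, ← mul_assoc, hec₂]
  have heg : e₁ * g = g := by rw [hg, pow_succ', ← mul_assoc, ← mul_assoc, hea]
  have heh : e₂ * h = h := by rw [hh, pow_succ', ← mul_assoc, ← mul_assoc, heb]
  -- If fs = s, then sf is an idempotent R-related to s, hence equal to s.
  have absorb : ∀ {f s : M}, IsIdempotentElem f → f * s = s → IsIdempotentElem s →
      s * f = s := by
    intro f s hf hfs hs
    refine hM.right _ _ ?_ hs ?_ ?_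
    · rw [IsIdempotentElem, mul_assoc, ← mul_assoc f, hfs, ← mul_assoc, hs.eq]
    · rw [mul_assoc, hfs, hs.eq]
    · rw [← mul_assoc, hs.eq]
  have hge := absorb he₁ heg hk
  have hhe := absorb he₂ heh hl
  have hga : g * a = a * h := by
    rw [hg, hh]
    exact ((show SemiconjBy a (b * a) (a * b) from (mul_assoc a b a).symm).pow_right _).eq.symm
  have hhb : h * b = b * g := by
    rw [hg, hh]
    exact ((show SemiconjBy b (a * b) (b * a) from (mul_assoc b a b).symm).pow_right _).eq.symm
  have hgs : g = a * h * (b * (a * b) ^ n) := by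
    calc g = g * g := hk.eq.symm
      _ = g * ((a * b) * (a * b) ^ n) := by rw [← pow_succ', ← hg]
      _ = g * a * (b * (a * b) ^ n) := by simp only [mul_assoc]
      _ = _ := by rw [hga]
  have hhs : h = b * g * (a * (b * a) ^ n) := by
    calc h = h * h := hl.eq.symm
      _ = h * ((b * a) * (b * a) ^ n) := by rw [← pow_succ', ← hh]
      _ = h * b * (a * (b * a) ^ n) := by simp only [mul_assoc]
      _ = _ := by rw [hhb]
  have hgh : JRel g h := ⟨⟨_, _, hgs⟩, ⟨_, _, hhs⟩⟩
  have hz₁ : g * c₁ * z₂ = g := by rw [mul_assoc, hc₁, hge]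
  have hz₂ : h * c₂ * z₂ = h := by rw [mul_assoc, hc₂, hhe]
  have rg : RRel (g * c₁) g := ⟨⟨_, rfl⟩, ⟨_, hz₁.symm⟩⟩
  have rh : RRel (h * c₂) h := ⟨⟨_, rfl⟩, ⟨_, hz₂.symm⟩⟩
  have hJ : JRel (g * c₁) (h * c₂) := (rg.jRel.trans hgh).trans rh.jRel.symm
  have e1 : g * c₁ * z₁ * (h * c₂) = a * (h * c₂) := by
    rw [mul_assoc g, ← ha, hga, mul_assoc, ← mul_assoc h h, hl.eq]
  have e2 : h * c₂ * z₁ * (g * c₁) = b * (g * c₁) := by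
    rw [mul_assoc h, ← hb, hhb, mul_assoc, ← mul_assoc g g, hk.eq]
  have l1 : LRel (a * (h * c₂)) (h * c₂) := by
    refine ⟨⟨_, rfl⟩, ⟨(b * a) ^ n * b, ?_⟩⟩
    rw [mul_assoc, ← mul_assoc b a, ← mul_assoc, ← pow_succ, ← hh, ← mul_assoc, hl.eq]
  have l2 : LRel (b * (g * c₁)) (g * c₁) := by
    refine ⟨⟨_, rfl⟩, ⟨(a * b) ^ n * a, ?_⟩⟩
    rw [mul_assoc, ← mul_assoc a b, ← mul_assoc, ← pow_succ, ← hg, ← mul_assoc, hk.eq]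
  have hR := hP _ _ rfl rfl hJ (by rw [e1]; exact l1.jRel.trans hJ.symm)
    (by rw [e2]; exact l2.jRel)
    (by rw [hz₁, ← mul_assoc, hk.eq]; exact JRel.refl _)
    (by rw [hz₂, ← mul_assoc, hl.eq]; exact hJ.symm)
  rw [hge, hhe]
  exact hM.eq_of_rRel hk hl ((rg.symm.trans hR).trans rh)

variable [Finite M]

/-- Stability gives y = (yv)ys for some s; after iteration an idempotent power of yv is absorbed on
the left. -/
theorem pow_mul_eq_of_jRel {y v : M} (h : JRel (y * v * y) y) {k : ℕ}
    (hk : IsIdempotentElem ((y * v) ^ (k + 1))) : (y * v) ^ (k + 1) * y = y := by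
  rw [mul_assoc] at h
  obtain ⟨s, hs⟩ := (rRel_mul_right h).2
  have h1 := eq_pow_mul_mul_pow (u := y * v) (x := y) (v := s)
    (by simpa only [mul_assoc] using hs) (k + 1)
  generalize (y * v) ^ (k + 1) = f at *
  conv_lhs => rw [h1]
  rw [← mul_assoc, ← mul_assoc, hk.eq, ← h1]

theorem mul_pow_eq_of_jRel {y v : M} (h : JRel (y * v * y) y) {k : ℕ}
    (hk : IsIdempotentElem ((v * y) ^ (k + 1))) : y * (v * y) ^ (k + 1) = y := by
  obtain ⟨s, hs⟩ := (lRel_mul_left h).2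
  have h1 := eq_pow_mul_mul_pow (u := s) (x := y) (v := v * y)
    (by simpa only [mul_assoc] using hs) (k + 1)
  generalize (v * y) ^ (k + 1) = f at *
  conv_lhs => rw [h1]
  rw [mul_assoc, hk.eq, ← h1]

/-- zx and zy are R-related, hence so are their idempotent powers, which therefore coincide. This
common idempotent fixes x and y on the right and ends in each of them. -/
theorem IsBlockMonoid.lRel_of_rRel (hM : IsBlockMonoid M) {x y z : M} (h : RRel x y)
    (hx : JRel (x * z * x) x) (hy : JRel (y * z * y) y) : LRel x y := by
  obtain ⟨k, hk⟩ := exists_isIdempotentElem_pow_succ (z * x)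
  obtain ⟨l, hl⟩ := exists_isIdempotentElem_pow_succ (z * y)
  have key : ∀ {a : M} {n : ℕ}, JRel (a * z * a) a → IsIdempotentElem ((z * a) ^ (n + 1)) →
      RRel ((z * a) ^ (n + 1)) (z * a) := fun {a n} ha hn =>
    ⟨⟨(z * a) ^ n, pow_succ' _ _⟩, ⟨z * a, by
      rw [← pow_succ, pow_succ', mul_assoc z a, mul_pow_eq_of_jRel ha hn]⟩⟩
  have hza : RRel (z * x) (z * y) := by
    obtain ⟨⟨u, hu⟩, ⟨v, hv⟩⟩ := h
    exact ⟨⟨u, by rw [mul_assoc, ← hu]⟩, ⟨v, by rw [mul_assoc, ← hv]⟩⟩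
  have hkl := hM.eq_of_rRel hk hl (((key hx hk).trans hza).trans (key hy hl).symm)
  have h1 := mul_pow_eq_of_jRel hx hk
  have h2 := mul_pow_eq_of_jRel hy hl
  rw [hkl, pow_succ, ← mul_assoc, ← mul_assoc] at h1
  rw [← hkl, pow_succ, ← mul_assoc, ← mul_assoc] at h2
  exact ⟨⟨_, h1.symm⟩, ⟨_, h2.symm⟩⟩

/-- The exponent 2k+1 plays the role of ω-1: one more factor yz gives the square of the idempotent
power, which fixes y. So (yz)^{ω-1}y may replace y up to H. -/
theorem pow_mul_rRel_and_lRel {y z : M} (h : JRel (y * z * y) y) {k : ℕ}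
    (hk : IsIdempotentElem ((y * z) ^ (k + 1))) :
    RRel ((y * z) ^ (2 * k + 1) * y) y ∧ LRel ((y * z) ^ (2 * k + 1) * y) y := by
  have hL : LRel ((y * z) ^ (2 * k + 1) * y) y := by
    refine ⟨⟨_, rfl⟩, ⟨y * z, ?_⟩⟩
    rw [← mul_assoc, ← pow_succ', show 2 * k + 1 + 1 = (k + 1) + (k + 1) by ring, pow_add, hk.eq,
      pow_mul_eq_of_jRel h hk]
  exact ⟨rRel_of_jRel hL.jRel ⟨z * (y * z) ^ (2 * k) * y, by
    rw [pow_succ']; simp only [mul_assoc]⟩, hL⟩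

/-- Under the hypotheses of `P₂`, the term `Δ(y₁, y₂; z₁, z₂)` reduces to `(y₁ z₂) ^ ω`. -/
theorem delta_reduction {y₁ y₂ z₁ z₂ : M} (hJ : JRel y₁ y₂)
    (h1 : JRel (y₁ * z₁ * y₂) y₁) (h2 : JRel (y₂ * z₁ * y₁) y₁)
    (h3 : JRel (y₁ * z₂ * y₁) y₁) (h4 : JRel (y₂ * z₂ * y₂) y₂) {k l n : ℕ}
    (hk : IsIdempotentElem ((y₁ * z₂) ^ (k + 1))) (hl : IsIdempotentElem ((y₂ * z₂) ^ (l + 1)))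
    (hn : IsIdempotentElem (((y₁ * z₂) ^ (2 * k + 1) * y₁ * z₁ *
      ((y₂ * z₂) ^ (2 * l + 1) * y₂) * z₁) ^ (n + 1))) :
    ((y₁ * z₂) ^ (2 * k + 1) * y₁ * z₁ * ((y₂ * z₂) ^ (2 * l + 1) * y₂) * z₁) ^ (n + 1) *
      (y₁ * z₂) ^ (k + 1) = (y₁ * z₂) ^ (k + 1) := by
  obtain ⟨r1, l1⟩ := pow_mul_rRel_and_lRel h3 hk
  obtain ⟨r2, l2⟩ := pow_mul_rRel_and_lRel h4 hl
  generalize (y₁ * z₂) ^ (2 * k + 1) * y₁ = c₁ at *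
  generalize (y₂ * z₂) ^ (2 * l + 1) * y₂ = c₂ at *
  have j1 : JRel (c₁ * z₁ * c₂) y₁ := (JRel.mul_of_lRel_rRel l1 r2 z₁).trans h1
  have r3 : RRel (c₁ * z₁ * c₂) y₁ :=
    (rRel_of_jRel (j1.trans r1.jRel.symm) ⟨_, mul_assoc _ _ _⟩).trans r1
  have l3 : LRel (c₁ * z₁ * c₂) y₂ :=
    (lRel_of_jRel (j1.trans (hJ.trans l2.jRel.symm)) ⟨_, rfl⟩).trans l2
  have j2 := (JRel.mul_of_lRel_rRel l3 (RRel.refl y₁) z₁).trans h2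
  -- The base of the outer power thus has the form y₁(vz₁), so its idempotent power fixes y₁ and
  -- everything that begins with y₁.
  obtain ⟨v, hv⟩ := r3.1
  rw [hv, mul_assoc y₁] at hn j2 ⊢
  have h5 := pow_mul_eq_of_jRel j2 hn
  rw [pow_succ' (y₁ * z₂), mul_assoc y₁ z₂, ← mul_assoc, h5]

end Delta

/-! ### The κ-identity and Property P₂. -/

section KappaIdentity

variable {S : Type u} [Semigroup S] [Finite S]

theorem coe_omegaPred (t : S) :
    ((omegaPred t : S) : WithOne S) = (t : WithOne S) ^ (2 * omegaIndex t + 1) ∧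
      ((omegaPred t * t : S) : WithOne S) = (t : WithOne S) ^ (omegaIndex t + 1) ∧
      IsIdempotentElem ((t : WithOne S) ^ (omegaIndex t + 1)) := by
  obtain ⟨h1, h2⟩ := omegaPred_mul_self t
  refine ⟨coe_powSucc _ _, by rw [h1, coe_powSucc], ?_⟩
  rw [← coe_powSucc, IsIdempotentElem, ← WithOne.coe_mul, h2.eq]

/-- The value of `Δ(y₁, y₂; z₁, z₂)`. -/
noncomputable def deltaValue (y₁ y₂ z₁ z₂ : S) : S :=
  omegaPred (omegaPred (y₁ * z₂) * y₁ * z₁ * omegaPred (y₂ * z₂) * y₂ * z₁) *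
    (omegaPred (y₁ * z₂) * y₁ * z₁ * omegaPred (y₂ * z₂) * y₂ * z₁) *
    (omegaPred (y₁ * z₂) * (y₁ * z₂))

theorem mem_MNstar_iff (T : FiniteSemigroup.{u}) : T ∈ FiniteSemigroup.MNstar.{u} ↔
    ∀ y₁ y₂ z₁ z₂ : T.carrier, deltaValue y₁ y₂ z₁ z₂ = deltaValue y₂ y₁ z₁ z₂ :=
  ⟨fun h y₁ y₂ z₁ z₂ => h ![y₁, y₂, z₁, z₂], fun h f => h (f 0) (f 1) (f 2) (f 3)⟩

/-- Puts Δ in the form of `delta_eq_of_rRel`. The middle equation exhibits the outer ω-power as an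
element of S, which is needed because P₂ speaks of elements of S only. -/
theorem coe_deltaValue (y₁ y₂ z₁ z₂ : S) : ∃ n : ℕ,
    IsIdempotentElem ((((y₁ : WithOne S) * z₂) ^ (2 * omegaIndex (y₁ * z₂) + 1) * y₁ * z₁ *
      (((y₂ : WithOne S) * z₂) ^ (2 * omegaIndex (y₂ * z₂) + 1) * y₂) * z₁) ^ (n + 1)) ∧
    ((omegaPred (omegaPred (y₁ * z₂) * y₁ * z₁ * omegaPred (y₂ * z₂) * y₂ * z₁) *
      (omegaPred (y₁ * z₂) * y₁ * z₁ * omegaPred (y₂ * z₂) * y₂ * z₁) : S) : WithOne S) =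
      (((y₁ : WithOne S) * z₂) ^ (2 * omegaIndex (y₁ * z₂) + 1) * y₁ * z₁ *
      (((y₂ : WithOne S) * z₂) ^ (2 * omegaIndex (y₂ * z₂) + 1) * y₂) * z₁) ^ (n + 1) ∧
    ((deltaValue y₁ y₂ z₁ z₂ : S) : WithOne S) =
      (((y₁ : WithOne S) * z₂) ^ (2 * omegaIndex (y₁ * z₂) + 1) * y₁ * z₁ *
      (((y₂ : WithOne S) * z₂) ^ (2 * omegaIndex (y₂ * z₂) + 1) * y₂) * z₁) ^ (n + 1) *
        ((y₁ : WithOne S) * z₂) ^ (omegaIndex (y₁ * z₂) + 1) := by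
  obtain ⟨h1, h2, h3⟩ :=
    coe_omegaPred (omegaPred (y₁ * z₂) * y₁ * z₁ * omegaPred (y₂ * z₂) * y₂ * z₁)
  have e : ((omegaPred (y₁ * z₂) * y₁ * z₁ * omegaPred (y₂ * z₂) * y₂ * z₁ : S) : WithOne S) =
      ((y₁ : WithOne S) * z₂) ^ (2 * omegaIndex (y₁ * z₂) + 1) * y₁ * z₁ *
      (((y₂ : WithOne S) * z₂) ^ (2 * omegaIndex (y₂ * z₂) + 1) * y₂) * z₁ := by
    simp only [WithOne.coe_mul, (coe_omegaPred _).1, mul_assoc]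
  rw [e] at h2 h3
  refine ⟨_, h3, h2, ?_⟩
  rw [deltaValue, WithOne.coe_mul, h2, (coe_omegaPred (y₁ * z₂)).2.1, WithOne.coe_mul]

theorem coe_deltaValue_of_jRel {y₁ y₂ z₁ z₂ : S} (hJ : JRel (y₁ : WithOne S) y₂)
    (h1 : JRel (y₁ * z₁ * y₂ : WithOne S) y₁) (h2 : JRel (y₂ * z₁ * y₁ : WithOne S) y₁)
    (h3 : JRel (y₁ * z₂ * y₁ : WithOne S) y₁) (h4 : JRel (y₂ * z₂ * y₂ : WithOne S) y₂) :
    ((deltaValue y₁ y₂ z₁ z₂ : S) : WithOne S) =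
      ((y₁ : WithOne S) * z₂) ^ (omegaIndex (y₁ * z₂) + 1) := by
  obtain ⟨n, hn, -, hd⟩ := coe_deltaValue y₁ y₂ z₁ z₂
  rw [hd]
  refine delta_reduction hJ h1 h2 h3 h4 ?_ ?_ hn
  · rw [← WithOne.coe_mul]; exact (coe_omegaPred _).2.2
  · rw [← WithOne.coe_mul]; exact (coe_omegaPred _).2.2

theorem propertyP₂_of_deltaValue (hM : IsBlockMonoid (WithOne S))
    (h : ∀ y₁ y₂ z₁ z₂ : S, deltaValue y₁ y₂ z₁ z₂ = deltaValue y₂ y₁ z₁ z₂) :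
    PropertyP₂ S := by
  rintro y₁ y₂ hJ ⟨z₁, z₂, h1, h2, h3, h4⟩
  change JRel (y₁ : WithOne S) y₂ at hJ
  change JRel (y₁ * z₁ * y₂ : WithOne S) y₁ at h1
  change JRel (y₂ * z₁ * y₁ : WithOne S) y₁ at h2
  change JRel (y₁ * z₂ * y₁ : WithOne S) y₁ at h3
  change JRel (y₂ * z₂ * y₂ : WithOne S) y₁ at h4
  have h4' := h4.trans hJ
  have e := congrArg (fun s : S => (s : WithOne S)) (h y₁ y₂ z₁ z₂)
  rw [coe_deltaValue_of_jRel hJ h1 h2 h3 h4',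
    coe_deltaValue_of_jRel hJ.symm (h2.trans hJ) (h1.trans hJ) h4' h3] at e
  have k1 := pow_mul_eq_of_jRel h3 (k := omegaIndex (y₁ * z₂))
    (by rw [← WithOne.coe_mul]; exact (coe_omegaPred _).2.2)
  have k2 := pow_mul_eq_of_jRel h4' (k := omegaIndex (y₂ * z₂))
    (by rw [← WithOne.coe_mul]; exact (coe_omegaPred _).2.2)
  -- The common idempotent (y₁z₂)^ω = (y₂z₂)^ω fixes both y₁ and y₂ on the left and begins with each
  -- of them, so y₁ R y₂.
  rw [e, pow_succ', mul_assoc, mul_assoc] at k1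
  rw [← e, pow_succ', mul_assoc, mul_assoc] at k2
  have hR : RRel (y₁ : WithOne S) y₂ := ⟨⟨_, k1.symm⟩, ⟨_, k2.symm⟩⟩
  exact ⟨hM.lRel_of_rRel hR h3 h4', hR⟩

theorem PropertyP₂.deltaValue_eq (hP : PropertyP₂ S) (hM : IsBlockMonoid (WithOne S))
    (y₁ y₂ z₁ z₂ : S) : deltaValue y₁ y₂ z₁ z₂ = deltaValue y₂ y₁ z₁ z₂ := by
  apply WithOne.coe_injective
  obtain ⟨n, hn, hg, hd⟩ := coe_deltaValue y₁ y₂ z₁ z₂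
  obtain ⟨n', hn', hh, hd'⟩ := coe_deltaValue y₂ y₁ z₁ z₂
  rw [hd, hd']
  have hi : ∀ y : S, IsIdempotentElem (((y : WithOne S) * z₂) ^ (omegaIndex (y * z₂) + 1)) := by
    intro y
    rw [← WithOne.coe_mul]
    exact (coe_omegaPred _).2.2
  have hc : ∀ y : S, ((y : WithOne S) * z₂) ^ (2 * omegaIndex (y * z₂) + 1) * y * z₂ =
      ((y : WithOne S) * z₂) ^ (omegaIndex (y * z₂) + 1) := by
    intro y
    conv_rhs => rw [← (hi y).eq, ← pow_add]
    rw [mul_assoc, ← pow_succ]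
    congr 1
    ring
  have hec : ∀ y : S, ((y : WithOne S) * z₂) ^ (omegaIndex (y * z₂) + 1) *
      (((y : WithOne S) * z₂) ^ (2 * omegaIndex (y * z₂) + 1) * y) =
      ((y : WithOne S) * z₂) ^ (2 * omegaIndex (y * z₂) + 1) * y := by
    intro y
    rw [← mul_assoc, show 2 * omegaIndex (y * z₂) + 1 = omegaIndex (y * z₂) + 1 +
      omegaIndex (y * z₂) by ring, pow_add _ (omegaIndex (y * z₂) + 1), ← mul_assoc, (hi y).eq]
  refine delta_eq_of_rRel hM (hi y₁) (hi y₂) (hc y₁) (hc y₂) (hec y₁) (hec y₂) hn hn' ?_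
  intro a b ha hb hJ h1 h2 h3 h4
  rw [← hg, ← WithOne.coe_mul y₁, ← (coe_omegaPred _).1, ← WithOne.coe_mul,
    ← WithOne.coe_mul] at ha
  rw [← hh, ← WithOne.coe_mul y₂, ← (coe_omegaPred _).1, ← WithOne.coe_mul,
    ← WithOne.coe_mul] at hb
  subst ha hb
  exact (hP _ _ hJ ⟨z₁, z₂, h1, h2, h3, h4⟩).2

end KappaIdentity

theorem mainTheorem1 :
    FiniteSemigroup.MN.{u} = FiniteSemigroup.MNstar.{u} ∩ FiniteSemigroup.BGnil.{u} ∧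
      ∀ S ∈ FiniteSemigroup.BGnil.{u},
        S ∈ FiniteSemigroup.MN.{u} ↔ PropertyP₂ S.carrier := by
  have key : ∀ S ∈ FiniteSemigroup.BGnil.{u},
      S ∈ FiniteSemigroup.MN.{u} ↔ PropertyP₂ S.carrier := fun S hS =>
    ⟨fun h => IsMalcevNilpotent.propertyP₂ h, fun h => h.isMalcevNilpotent hS.1 hS.2⟩
  refine ⟨Set.ext fun S => ⟨fun h => ?_, fun h => ?_⟩, key⟩
  · have hM := IsMalcevNilpotent.isBlockMonoid h
    have hS : S ∈ FiniteSemigroup.BGnil.{u} :=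
      ⟨isBlockMonoid_withOne_iff.mp hM, IsMalcevNilpotent.hasNilpotentSubgroups h⟩
    exact ⟨(mem_MNstar_iff S).mpr (((key S hS).mp h).deltaValue_eq hM), hS⟩
  · exact (key S h.2).mpr (propertyP₂_of_deltaValue (isBlockMonoid_withOne_iff.mpr h.2.1)
      ((mem_MNstar_iff S).mp h.1))
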